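/- Let $L$ be a locally compact Hausdorff space for which there is a continuous surjection $\varphi:L\to\omega_1$ (with the order topology on $\omega_1$) all of whose fibres are finite, and let $K=L\cup\{\infty\}$ be its one-point compactification. Assume that $L$ has the collapsing property, that is: let $m,k\ge 1$, let $(I_1,\dots,I_k)$ be any ordered partition of $\{1,\dots,m\}$ into nonempty sets, and for $x\in L^m$ put $G_j^x=\{x_i:i\in I_j\}$. If $\mathcal C\subset L^m$ is uncountable, $|G_j^x|$ does not depend on $x\in\mathcal C$ for each $j$, and $G_i^x\cap G_j^y=\emptyset$ for $x,y\in\mathcal C$ whenever $i\ne j$ or $x\neq y$, then $\mathcal C$ has an accumulation point $q\in K^m$ for which there are distinct points $a_1,\dots,a_k\in K$ with $a_k=\infty$ and $q_i=a_j$ for all $j$ and all $i\in I_j$. Let $C_0(L\times L)$ be the Banach space of real continuous functions on $L\times L$ vanishing at infinity with the supremum norm, $I$ its identity operator and $(Jf)(x,y)=f(y,x)$. Let $C_0(\Omega_1)$ and $C_0(\Omega_2)$ denote the ranges of the projections $P_1=\frac12(I+J)$ and $P_2=\frac12(I-J)$, i.e. the subspaces of symmetric and of antisymmetric functions. Then there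 is no injective bounded linear operator from $C_0(\Omega_1)$ into $C_0(\Omega_2)$, and none from $C_0(\Omega_2)$ into $C_0(\Omega_1)$. Hence $C_0(\Omega_1)$ and $C_0(\Omega_2)$ are not linearly isomorphic as Banach spaces, and neither of them is linearly isomorphic to $C_0(L\times L)$. -/

import Mathlib

open Filter Topology
open scoped ZeroAtInfty

namespace CollapsingSpace

/-- The space `ω₁` of all countable ordinals. As an initial segment of the ordinals, its subspace
topology is its order topology. -/
abbrev OmegaOne : Type 1 := Set.Iio (Ordinal.omega.{0} 1)

/-- There is a continuous finite-to-one surjection `φ : L → ω₁`. The class `𝒮` consists of the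
locally compact Hausdorff spaces with this property. -/
def HasFiniteToOneMap (L : Type*) [TopologicalSpace L] : Prop :=
  ∃ φ : L → OmegaOne,
    Continuous φ ∧ Function.Surjective φ ∧ ∀ α : OmegaOne, (φ ⁻¹' {α}).Finite

/-- A partition `(I_1, …, I_k)` of the index set of `L^m` is given by a map
`c : Fin m → Fin k` (surjective, i.e. with nonempty blocks, wherever it is used), whose fibre
over `j` is the `j`-th block. `block c x j` is the set `{x_i : i ∈ I_j}`. -/
def block {L : Type*} {m k : ℕ} (c : Fin m → Fin k) (x : Fin m → L) (j : Fin k) : Set L :=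
  x '' (c ⁻¹' {j})

/-- `C ⊆ L^m` is `(I_1, …, I_k)`-separated: the cardinality of the `j`-th block
`{x_i : i ∈ I_j}` is a nonzero number independent of `x ∈ C`, and blocks with different indices or
belonging to different elements of `C` are disjoint. -/
def IsSeparated {L : Type*} {m k : ℕ} (c : Fin m → Fin k) (C : Set (Fin m → L)) : Prop :=
  (∃ μ : Fin k → ℕ, ∀ j, μ j ≠ 0 ∧ ∀ x ∈ C, (block c x j).ncard = μ j) ∧
  ∀ x ∈ C, ∀ y ∈ C, ∀ i j : Fin k, (i ≠ j ∨ x ≠ y) → Disjoint (block c x i) (block c y j)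

/-- `C ⊆ L^m` collapses with respect to the partition `(I_1, …, I_{k+1})`: in `K^m`, where
`K = L ∪ {∞}` is the one-point compactification, `C` has an accumulation point `q` that takes a
constant value `a_j` on each block `I_j`, with `a_1, …, a_{k+1}` pairwise distinct points of `K`
and `a_{k+1} = ∞` for the last block. -/
def Collapses {L : Type*} [TopologicalSpace L] {m k : ℕ} (c : Fin m → Fin (k + 1))
    (C : Set (Fin m → L)) : Prop :=
  ∃ (q : Fin m → OnePoint L) (a : Fin (k + 1) → OnePoint L),
    AccPt q (𝓟 ((fun (x : Fin m → L) (i : Fin m) => (x i : OnePoint L)) '' C)) ∧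
    Function.Injective a ∧ a (Fin.last k) = OnePoint.infty ∧
    ∀ i : Fin m, q i = a (c i)

/-- The collapsing property: for every partition of `{1, …, m}` into nonempty (ordered) blocks,
every uncountable separated subset of `L^m` collapses. -/
def CollapsingProperty (L : Type*) [TopologicalSpace L] : Prop :=
  ∀ (m k : ℕ) (c : Fin m → Fin (k + 1)), Function.Surjective c →
    ∀ C : Set (Fin m → L), ¬ C.Countable → IsSeparated c C → Collapses c C

noncomputable section

/-- The function `(x, y) ↦ f (y, x)` in `C₀(L × L)`. -/
def transpose {L : Type*} [TopologicalSpace L] (f : C₀(L × L, ℝ)) : C₀(L × L, ℝ) :=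
  f.comp (Homeomorph.prodComm L L).toCocompactMap

@[simp] theorem transpose_apply {L : Type*} [TopologicalSpace L] (f : C₀(L × L, ℝ)) (x y : L) :
    transpose f (x, y) = f (y, x) := rfl

/-- The bounded operator `J : C₀(L × L) → C₀(L × L)`, `J f (x, y) = f (y, x)`. -/
def J (L : Type*) [TopologicalSpace L] : C₀(L × L, ℝ) →L[ℝ] C₀(L × L, ℝ) :=
  LinearMap.mkContinuous
    { toFun := transpose
      map_add' := fun _ _ => rfl
      map_smul' := fun _ _ => rfl } 1 (by
    intro f
    rw [one_mul, ← ZeroAtInftyContinuousMap.norm_toBCF_eq_norm,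
      BoundedContinuousFunction.norm_le (norm_nonneg f)]
    intro p
    rw [← ZeroAtInftyContinuousMap.norm_toBCF_eq_norm (f := f)]
    exact f.toBCF.norm_coe_le_norm (p.2, p.1))

@[simp] theorem J_apply {L : Type*} [TopologicalSpace L] (f : C₀(L × L, ℝ)) (x y : L) :
    J L f (x, y) = f (y, x) := rfl

/-- The natural projection `P₁ = (I + J) / 2`. -/
def P₁ (L : Type*) [TopologicalSpace L] : C₀(L × L, ℝ) →L[ℝ] C₀(L × L, ℝ) :=
  (1 / 2 : ℝ) • (ContinuousLinearMap.id ℝ C₀(L × L, ℝ) + J L)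

/-- The natural projection `P₂ = (I - J) / 2`. -/
def P₂ (L : Type*) [TopologicalSpace L] : C₀(L × L, ℝ) →L[ℝ] C₀(L × L, ℝ) :=
  (1 / 2 : ℝ) • (ContinuousLinearMap.id ℝ C₀(L × L, ℝ) - J L)

/-- The range of `P₁` (the symmetric functions), with the supremum norm. -/
abbrev SymmRange (L : Type*) [TopologicalSpace L] : Submodule ℝ C₀(L × L, ℝ) :=
  LinearMap.range (P₁ L).toLinearMap

/-- The range of `P₂` (the antisymmetric functions), with the supremum norm. -/
abbrev AntisymmRange (L : Type*) [TopologicalSpace L] : Submodule ℝ C₀(L × L, ℝ) :=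
  LinearMap.range (P₂ L).toLinearMap

theorem mem_symmRange {L : Type*} [TopologicalSpace L] (f : C₀(L × L, ℝ)) :
    f ∈ SymmRange L ↔ ∀ x y, f (x, y) = f (y, x) := by
  constructor
  · rintro ⟨g, rfl⟩ x y
    simp [P₁, add_comm]
  · intro h
    refine ⟨f, ?_⟩
    ext ⟨x, y⟩
    simp [P₁, ← h x y]
    ring

theorem mem_antisymmRange {L : Type*} [TopologicalSpace L] (f : C₀(L × L, ℝ)) :
    f ∈ AntisymmRange L ↔ ∀ x y, f (x, y) = -f (y, x) := by
  constructor
  · rintro ⟨g, rfl⟩ x y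
    simp [P₂]
    ring
  · intro h
    refine ⟨f, ?_⟩
    ext ⟨x, y⟩
    simp [P₂, h y x]
    ring

end

end CollapsingSpace

/-!
Let `J` exchange the coordinates of `L × L`. The theorem holds because a bounded operator `T` that
sends functions with `J f = ε f` to functions with `J f = -ε f`, where `ε = ±1`, annihilates some
nonzero function (`exists_ne_zero_of_antisymm`). The last two claims follow from the first two by
composing an isomorphism with an inclusion.

The fibres of `L → ω₁` over successor ordinals consist of isolated points, so there are uncountably
many disjoint pairs `p ≠ q` of isolated points, and for each of them a function `e` of type `ε`
living on `{(p, q), (q, p)}`. Assume that `T e ≠ 0` for all of them, say `T e (x, y) ≠ 0`. Since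
compact subsets of `L × L` are countable, the functional `f ↦ T f (x, y)` is almost carried by a
finite set (`exists_finset_forall_abs_le`). Thinning out and applying the Δ-system lemma
(`exists_deltaSystem`) gives an uncountable family for which these finite sets consist of a common
root and pairwise disjoint petals, for which `|T e (x, y)|` is bounded below and the sign is
constant, and for which `p, q, x, y` have constant positions (`OperatorFamily`).

The collapsing property, applied to several copies of such a family at a time, makes the coordinates
of the copies converge to prescribed patterns of points of `L` and `∞`; the points of `L` may be
taken off the root, so that there are test functions `f` near them that vanish on the root
(`exists_collapsing_bumps`). Two patterns yield a contradiction.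

* If `(x, y)` does not involve `q`, say, then `p` converges to `a` in two copies, while `q` converges
  to `b` in one of them and to `∞` in the other. All remaining points of the petals tend to `∞`. The
  points `(x, y)` of both copies have the same limit in the square of the one-point
  compactification, to which `T f` extends continuously. For `f` of type `ε` living near `(a, b)`
  and `(b, a)`, however, `T f (x, y)` is close to `T e (x, y)` in the first copy and to `0` in the
  second (`OperatorFamily.exists_abs_le_of_ne`).
* If `(x, y) = (p, q)`, then `(p, q)` converges to `(a, b)` in one copy and to `(b, a)` in the
  other. The same `f` gives `T f (p, q) ≈ T e (p, q)` in the first and `T f (p, q) ≈ ε T e (p, q)`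
  in the second copy. As `T f (b, a) = -ε T f (a, b)`, the numbers `T e (p, q)` for the two copies
  are almost opposite to each other, whereas their signs are equal
  (`OperatorFamily.exists_mul_le_of_eq`).
-/

open scoped CompactlySupported

namespace CollapsingSpace

/-! ### Functionals on `C₀(X)` are almost carried by finite sets -/

section Functionals

variable {X : Type*} [TopologicalSpace X]

theorem norm_le_iff {f : C₀(X, ℝ)} {r : ℝ} (hr : 0 ≤ r) : ‖f‖ ≤ r ↔ ∀ x, |f x| ≤ r := by
  rw [← ZeroAtInftyContinuousMap.norm_toBCF_eq_norm, BoundedContinuousFunction.norm_le hr]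
  rfl

theorem abs_apply_le_norm (f : C₀(X, ℝ)) (x : X) : |f x| ≤ ‖f‖ :=
  (norm_le_iff (norm_nonneg f)).1 le_rfl x

theorem isCompact_le_abs (f : C₀(X, ℝ)) {η : ℝ} (hη : 0 < η) : IsCompact {x | η ≤ |f x|} := by
  have h : f ⁻¹' Metric.ball 0 η ∈ cocompact X := f.zero_at_infty' (Metric.ball_mem_nhds 0 hη)
  obtain ⟨t, ht, hts⟩ := mem_cocompact.1 h
  refine ht.of_isClosed_subset (isClosed_le continuous_const (map_continuous f).abs) ?_
  intro x hx
  by_contra hxt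
  have := hts hxt
  simp only [Set.mem_preimage, Metric.mem_ball, dist_zero_right, Real.norm_eq_abs] at this
  exact absurd hx (not_le.2 this)

/-- Every `f ∈ C₀(X)` is uniformly close to some `f'` with `|f'| ≤ |f|` that vanishes off a compact
set on which `f` has no zeros; `f'` is a soft thresholding of `f`. -/
theorem exists_threshold (f : C₀(X, ℝ)) {η : ℝ} (hη : 0 < η) :
    ∃ f' : C₀(X, ℝ), (∀ x, |f' x| ≤ |f x|) ∧ ‖f - f'‖ ≤ η ∧ ∀ x, |f x| < η → f' x = 0 := by
  have hc : Continuous fun t : ℝ => t - max (-η) (min η t) := by fun_prop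
  refine ⟨⟨⟨fun x => f x - max (-η) (min η (f x)), hc.comp (map_continuous f)⟩, ?_⟩, ?_, ?_, ?_⟩
  · have h0 : Tendsto (fun t : ℝ => t - max (-η) (min η t)) (𝓝 0) (𝓝 0) := by
      convert hc.tendsto 0 using 2
      simp [hη.le]
    exact h0.comp f.zero_at_infty'
  · intro x
    change |f x - max (-η) (min η (f x))| ≤ |f x|
    grind
  · rw [norm_le_iff hη.le]
    intro x
    change |f x - (f x - max (-η) (min η (f x)))| ≤ η
    grind
  · intro x hx
    change f x - max (-η) (min η (f x)) = 0
    grind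

/-- Off a suitable compact set disjoint from `Z`, a bounded functional is arbitrarily small on the
functions vanishing on `Z`: take a near-maximizer `f` among those of norm at most one and cut it
down to a compact set. If `g` is disjoint from it, then `f + g` is again a competitor. -/
theorem exists_isCompact_forall_abs_le (Λ : C₀(X, ℝ) →L[ℝ] ℝ) (Z : Set X) {ε : ℝ} (hε : 0 < ε) :
    ∃ C : Set X, IsCompact C ∧ Disjoint C Z ∧ ∀ g : C₀(X, ℝ), (∀ z ∈ Z, g z = 0) →
      (∀ z ∈ C, g z = 0) → |Λ g| ≤ ε * ‖g‖ := by
  set S : Set ℝ := {r | ∃ f : C₀(X, ℝ), ‖f‖ ≤ 1 ∧ (∀ z ∈ Z, f z = 0) ∧ Λ f = r} with hS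
  have hbdd : BddAbove S := by
    refine ⟨‖Λ‖, ?_⟩
    rintro r ⟨f, hf, -, rfl⟩
    exact (le_abs_self _).trans ((Λ.le_opNorm f).trans (mul_le_of_le_one_right (norm_nonneg _) hf))
  have hne : S.Nonempty := ⟨0, 0, by simp, by simp, by simp⟩
  obtain ⟨_, ⟨f, hf1, hfZ, rfl⟩, hf⟩ := exists_lt_of_lt_csSup hne (sub_lt_self (sSup S) (half_pos hε))
  have hη : 0 < ε / (2 * (‖Λ‖ + 1)) := by positivity
  obtain ⟨f', hle, hdist, hzero⟩ := exists_threshold f hη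
  have hΛ : |Λ f - Λ f'| ≤ ε / 2 := by
    rw [← map_sub]
    calc |Λ (f - f')| ≤ ‖Λ‖ * ‖f - f'‖ := Λ.le_opNorm _
      _ ≤ (‖Λ‖ + 1) * (ε / (2 * (‖Λ‖ + 1))) := by gcongr; linarith
      _ = ε / 2 := by field_simp
  have hunit : ∀ g : C₀(X, ℝ), ‖g‖ ≤ 1 → (∀ z ∈ Z, g z = 0) →
      (∀ z ∈ {x | ε / (2 * (‖Λ‖ + 1)) ≤ |f x|}, g z = 0) → Λ g ≤ ε := by
    intro g hg hgZ hgC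
    have hmem : Λ (f' + g) ∈ S := by
      refine ⟨f' + g, (norm_le_iff zero_le_one).2 fun x => ?_, fun z hz => ?_, rfl⟩
      · by_cases hx : ε / (2 * (‖Λ‖ + 1)) ≤ |f x|
        · rw [ZeroAtInftyContinuousMap.add_apply, hgC x hx, add_zero]
          exact (hle x).trans ((abs_apply_le_norm f x).trans hf1)
        · rw [ZeroAtInftyContinuousMap.add_apply, hzero x (not_le.1 hx), zero_add]
          exact (abs_apply_le_norm g x).trans hg
      · have := hle z
        rw [hfZ z hz, abs_zero] at this
        rw [ZeroAtInftyContinuousMap.add_apply, hgZ z hz, abs_nonpos_iff.1 this, add_zero]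
    have h1 := le_csSup hbdd hmem
    rw [map_add] at h1
    have h2 := (abs_le.1 hΛ).2
    linarith
  refine ⟨_, isCompact_le_abs f hη, ?_, ?_⟩
  · rw [Set.disjoint_left]
    intro x hx hxZ
    rw [Set.mem_ofPred_eq, hfZ x hxZ, abs_zero] at hx
    linarith
  · intro g hgZ hgC
    rcases eq_or_ne g 0 with rfl | hg
    · simp
    have hpos : 0 < ‖g‖ := norm_pos_iff.2 hg
    have key : ∀ s : ℝ, |s| = 1 → s * Λ g ≤ ε * ‖g‖ := by
      intro s hs
      have := hunit ((s * ‖g‖⁻¹) • g) (by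
        rw [norm_smul, norm_mul, Real.norm_eq_abs, hs, norm_inv, norm_norm, one_mul,
          inv_mul_cancel₀ hpos.ne'])
        (fun z hz => by simp [hgZ z hz]) (fun z hz => by simp [hgC z hz])
      rw [map_smul, smul_eq_mul] at this
      calc s * Λ g = (s * ‖g‖⁻¹ * Λ g) * ‖g‖ := by field_simp
        _ ≤ ε * ‖g‖ := by gcongr
    rw [abs_le']
    exact ⟨by simpa using key 1 (by simp), by simpa using key (-1) (by simp)⟩

/-- The product of `f ∈ C₀(X)` with a continuous function with values in `[0, 1]`. -/
noncomputable def mulUnit (f : C₀(X, ℝ)) (ψ : C(X, ℝ)) (hψ : ∀ x, ψ x ∈ Set.Icc (0 : ℝ) 1) :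
    C₀(X, ℝ) where
  toFun x := f x * ψ x
  continuous_toFun := (map_continuous f).mul ψ.continuous
  zero_at_infty' := by
    refine squeeze_zero_norm (fun x => ?_) (tendsto_norm_zero.comp f.zero_at_infty')
    rw [norm_mul]
    refine mul_le_of_le_one_right (norm_nonneg _) ?_
    rw [Real.norm_eq_abs, abs_of_nonneg (hψ x).1]
    exact (hψ x).2

theorem mulUnit_apply (f : C₀(X, ℝ)) (ψ : C(X, ℝ)) (hψ : ∀ x, ψ x ∈ Set.Icc (0 : ℝ) 1) (x : X) :
    mulUnit f ψ hψ x = f x * ψ x := rfl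

theorem norm_mulUnit_le (f : C₀(X, ℝ)) (ψ : C(X, ℝ)) (hψ : ∀ x, ψ x ∈ Set.Icc (0 : ℝ) 1) :
    ‖mulUnit f ψ hψ‖ ≤ ‖f‖ := by
  rw [norm_le_iff (norm_nonneg f)]
  intro x
  rw [mulUnit_apply, abs_mul, abs_of_nonneg (hψ x).1]
  exact (mul_le_of_le_one_right (abs_nonneg _) (hψ x).2).trans (abs_apply_le_norm f x)

/-- If compact subsets of `X` are countable, then every bounded functional on `C₀(X)` is, up to an
arbitrarily small error, carried by a finite set. This replaces the representation of functionals
by purely atomic measures. The masses away from the points of a countable compact set `C` are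
made summable by choosing small neighbourhoods, finitely many of which cover `C`. -/
theorem exists_finset_forall_abs_le [T2Space X] [LocallyCompactSpace X]
    (hX : ∀ C : Set X, IsCompact C → C.Countable) (Λ : C₀(X, ℝ) →L[ℝ] ℝ) {ε : ℝ} (hε : 0 < ε) :
    ∃ F : Finset X, ∀ g : C₀(X, ℝ), (∀ z ∈ F, g z = 0) → |Λ g| ≤ ε * ‖g‖ := by
  obtain ⟨C, hC, -, hΛC⟩ := exists_isCompact_forall_abs_le Λ ∅ (half_pos hε)
  obtain ⟨ε', hε', hsum⟩ := (hX C hC).exists_pos_forall_sum_le (half_pos hε)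
  have hloc : ∀ x : X, ∃ W : Set X, x ∈ W ∧ IsOpen W ∧ (∀ g : C₀(X, ℝ), g x = 0 →
      (∀ z ∉ W, g z = 0) → |Λ g| ≤ ε' x * ‖g‖) := by
    intro x
    obtain ⟨D, hD, hdisj, h⟩ := exists_isCompact_forall_abs_le Λ {x} (hε' x)
    refine ⟨Dᶜ, fun hx => Set.disjoint_right.1 hdisj rfl hx, hD.isClosed.isOpen_compl,
      fun g hg hgW => h g (by simpa using hg) fun z hz => hgW z (by simpa using hz)⟩
  choose W hxW hWo hW using hloc
  obtain ⟨F, hFC, hCF⟩ := hC.elim_nhds_subcover W fun x _ => (hWo x).mem_nhds (hxW x)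
  obtain ⟨ψ, hψW, -⟩ := PartitionOfUnity.exists_isSubordinate_of_locallyFinite_t2space hC
    (fun x : F => W x) (fun x => hWo x) (locallyFinite_of_finite _)
    (by simpa [Set.iUnion_subtype] using hCF)
  have hψ1 : ∀ i x, ψ i x ∈ Set.Icc (0 : ℝ) 1 := fun i x => ⟨ψ.nonneg i x, ψ.le_one i x⟩
  have hsumle : ∀ x, ∑ i, ψ i x ≤ 1 := fun x => by
    rw [← finsum_eq_sum_of_fintype]; exact ψ.sum_le_one x
  refine ⟨F, fun g hg => ?_⟩
  have hΨ : ∀ x, (1 - ∑ i, ψ i : C(X, ℝ)) x ∈ Set.Icc (0 : ℝ) 1 := by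
    intro x
    have h0 : 0 ≤ ∑ i, ψ i x := Finset.sum_nonneg fun i _ => ψ.nonneg i x
    have h1 := hsumle x
    simp only [ContinuousMap.sub_apply, ContinuousMap.one_apply, ContinuousMap.sum_apply]
    exact ⟨by linarith, by linarith⟩
  have hdecomp : g = mulUnit g _ hΨ + ∑ i, mulUnit g (ψ i) (hψ1 i) := by
    ext x
    have : (∑ i, mulUnit g (ψ i) (hψ1 i)) x = ∑ i, g x * ψ i x := by
      let ev : C₀(X, ℝ) →+ ℝ := ⟨⟨fun f => f x, rfl⟩, fun _ _ => rfl⟩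
      exact map_sum ev _ _
    rw [ZeroAtInftyContinuousMap.add_apply, this, mulUnit_apply, ← Finset.mul_sum, ← mul_add]
    simp
  have h1 : |Λ (mulUnit g _ hΨ)| ≤ ε / 2 * ‖g‖ := by
    refine (hΛC _ (by simp) fun z hz => ?_).trans
      (mul_le_mul_of_nonneg_left (norm_mulUnit_le _ _ _) (half_pos hε).le)
    have : ∑ i, ψ i z = 1 := by rw [← finsum_eq_sum_of_fintype]; exact ψ.sum_eq_one hz
    have h0 : (1 - ∑ i, ψ i : C(X, ℝ)) z = 0 := by
      simp only [ContinuousMap.sub_apply, ContinuousMap.one_apply, ContinuousMap.sum_apply, this,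
        sub_self]
    rw [mulUnit_apply, h0, mul_zero]
  have h2 : ∀ i : F, |Λ (mulUnit g (ψ i) (hψ1 i))| ≤ ε' i * ‖g‖ := by
    intro i
    refine (hW i _ ?_ fun z hz => ?_).trans
      (mul_le_mul_of_nonneg_left (norm_mulUnit_le _ _ _) (hε' i).le)
    · rw [mulUnit_apply, hg i i.2, zero_mul]
    · rw [mulUnit_apply, image_eq_zero_of_notMem_tsupport fun h => hz (hψW i h), mul_zero]
  have h3 : ∑ i : F, ε' i ≤ ε / 2 := by
    rw [Finset.sum_coe_sort F ε']
    exact hsum F fun x hx => hFC x hx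
  calc |Λ g| = |Λ (mulUnit g _ hΨ) + ∑ i, Λ (mulUnit g (ψ i) (hψ1 i))| := by
        conv_lhs => rw [hdecomp, map_add, map_sum]
    _ ≤ |Λ (mulUnit g _ hΨ)| + ∑ i, |Λ (mulUnit g (ψ i) (hψ1 i))| :=
        (abs_add_le _ _).trans (add_le_add_right (Finset.abs_sum_le_sum_abs _ _) _)
    _ ≤ ε / 2 * ‖g‖ + ∑ i : F, ε' i * ‖g‖ := add_le_add h1 (Finset.sum_le_sum fun i _ => h2 i)
    _ ≤ ε / 2 * ‖g‖ + ε / 2 * ‖g‖ := by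
        rw [← Finset.sum_mul]; gcongr
    _ = ε * ‖g‖ := by ring

end Functionals

/-! ### Extension to the one-point compactification -/

section Extension

variable {L : Type*} [TopologicalSpace L] [LocallyCompactSpace L] [T2Space L]

/-- A function in `C₀(L × L)` extends continuously, by zero, to `K × K`, where `K` is the one-point
compactification of `L`. -/
theorem exists_continuous_extension (f : C₀(L × L, ℝ)) :
    ∃ F : OnePoint L × OnePoint L → ℝ, Continuous F ∧ ∀ x y : L, F (x, y) = f (x, y) := by
  have hj : IsOpenEmbedding (Prod.map (↑) (↑) : L × L → OnePoint L × OnePoint L) :=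
    OnePoint.isOpenEmbedding_coe.prodMap OnePoint.isOpenEmbedding_coe
  set j : L × L → OnePoint L × OnePoint L := Prod.map (↑) (↑) with hjdef
  set F := Function.extend j f 0 with hF
  have hFj : ∀ z, F (j z) = f z := fun z => hj.injective.extend_apply _ _ _
  refine ⟨F, continuous_iff_continuousAt.2 fun w => ?_, fun x y => hFj (x, y)⟩
  by_cases hw : w ∈ Set.range j
  · obtain ⟨z, rfl⟩ := hw
    rw [← hj.continuousAt_iff]
    have : F ∘ j = f := funext hFj
    rw [this]
    exact (map_continuous f).continuousAt
  · have hFw : F w = 0 := Function.extend_apply' _ _ _ hw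
    rw [ContinuousAt, hFw, Metric.tendsto_nhds]
    intro ε hε
    have hC := ((isCompact_le_abs f hε).image hj.continuous).isClosed.isOpen_compl
    have hmem : w ∈ (j '' {x | ε ≤ |f x|})ᶜ := fun ⟨z, _, hz⟩ => hw ⟨z, hz⟩
    filter_upwards [hC.mem_nhds hmem] with v hv
    rw [dist_zero_right, Real.norm_eq_abs]
    by_cases hvr : v ∈ Set.range j
    · obtain ⟨z, rfl⟩ := hvr
      rw [hFj]
      by_contra hcon
      exact hv ⟨z, not_lt.1 hcon, rfl⟩
    · have : F v = 0 := Function.extend_apply' _ _ _ hvr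
      rwa [this, abs_zero]

end Extension

/-! ### The Δ-system lemma -/

section Combinatorics

theorem exists_not_countable_fiber {ι β : Type*} [Countable β] {S : Set ι} (hS : ¬ S.Countable)
    (f : ι → β) : ∃ b, ¬ {i ∈ S | f i = b}.Countable := by
  by_contra! h
  refine hS ((Set.countable_iUnion h).mono fun i hi => ?_)
  exact Set.mem_iUnion.2 ⟨f i, hi, rfl⟩

/-- The Δ-system lemma for uncountable families of finite sets. The root `R` is a set of largest
size that is contained in uncountably many members. A maximal subfamily with disjoint petals
among these members is uncountable, as each point off the root lies in only countably many
of them. -/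
theorem exists_deltaSystem {ι L : Type*} [DecidableEq L] {S : Set ι} (hS : ¬ S.Countable)
    (F : ι → Finset L) :
    ∃ (R : Finset L) (S' : Set ι), S' ⊆ S ∧ ¬ S'.Countable ∧ (∀ i ∈ S', R ⊆ F i) ∧
      S'.PairwiseDisjoint fun i => F i \ R := by
  obtain ⟨n, hn⟩ := exists_not_countable_fiber hS fun i => (F i).card
  set S₁ := {i ∈ S | (F i).card = n} with hS₁
  let P : ℕ → Prop := fun k => ∃ R : Finset L, R.card = k ∧ ¬ {i ∈ S₁ | R ⊆ F i}.Countable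
  have hP0 : P 0 := ⟨∅, rfl, by simpa using hn⟩
  have hPn : ∀ k, P k → k ≤ n := by
    rintro k ⟨R, rfl, hR⟩
    obtain ⟨i, hi, hRi⟩ : {i ∈ S₁ | R ⊆ F i}.Nonempty := by
      by_contra h
      rw [Set.not_nonempty_iff_eq_empty] at h
      exact hR (h ▸ Set.countable_empty)
    exact (Finset.card_le_card hRi).trans hi.2.le
  obtain ⟨k, ⟨R, hRk, hR⟩, hmax⟩ : ∃ k, P k ∧ ∀ k', P k' → k' ≤ k := by
    classical
    exact ⟨Nat.findGreatest P n, Nat.findGreatest_spec (Nat.zero_le n) hP0,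
      fun k' hk' => Nat.le_findGreatest (hPn k' hk') hk'⟩
  set I := {i ∈ S₁ | R ⊆ F i} with hI
  have hpt : ∀ z ∉ R, {i ∈ I | z ∈ F i}.Countable := by
    intro z hz
    by_contra hcon
    have : P (k + 1) := by
      refine ⟨insert z R, by rw [Finset.card_insert_of_notMem hz, hRk], fun hc => hcon ?_⟩
      refine hc.mono fun i hi => ?_
      exact ⟨hi.1.1, Finset.insert_subset hi.2 hi.1.2⟩
    have := hmax _ this
    omega
  obtain ⟨M, hM⟩ := zorn_subset {A : Set ι | A ⊆ I ∧ A.PairwiseDisjoint fun i => F i \ R} (by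
    intro c hc hchain
    refine ⟨⋃₀ c, ⟨Set.sUnion_subset fun A hA => (hc hA).1, ?_⟩, fun A hA =>
      Set.subset_sUnion_of_mem hA⟩
    exact (Set.pairwiseDisjoint_sUnion hchain.directedOn).2 fun A hA => (hc hA).2)
  refine ⟨R, M, fun i hi => (hM.prop.1 hi).1.1, fun hMc => hR ?_, fun i hi => (hM.prop.1 hi).2,
    hM.prop.2⟩
  have hU : (⋃ i ∈ M, ((F i \ R : Finset L) : Set L)).Countable :=
    hMc.biUnion fun i _ => (Finset.finite_toSet _).countable
  refine (hMc.union (hU.biUnion (t := fun z _ => {i ∈ I | z ∈ F i}) fun z hz => ?_)).mono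
    fun i hi => ?_
  · obtain ⟨j, -, hzj⟩ := Set.mem_iUnion₂.1 hz
    exact hpt z (Finset.mem_sdiff.1 hzj).2
  · by_contra hcon
    rw [Set.mem_union, not_or] at hcon
    refine hcon.1 (hM.le_of_ge (y := insert i M) ⟨Set.insert_subset hi hM.prop.1, ?_⟩
      (Set.subset_insert i M) (Set.mem_insert i M))
    refine hM.prop.2.insert fun j hj _ => Finset.disjoint_left.2 fun z hzi hzj => hcon.2 ?_
    exact Set.mem_iUnion₂.2 ⟨z, Set.mem_iUnion₂.2 ⟨j, hj, hzj⟩, hi, (Finset.mem_sdiff.1 hzi).1⟩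

end Combinatorics

/-! ### Spaces with a finite-to-one map onto `ω₁` -/

section FiniteToOne

theorem not_countable_omegaOne : ¬ (Set.univ : Set OmegaOne).Countable := by
  rw [Set.countable_univ_iff, ← Cardinal.mk_le_aleph0_iff, Cardinal.mk_Iio_ordinal]
  simp

theorem countable_Iic_omegaOne (β : OmegaOne) : (Set.Iic β).Countable := by
  have h : (Set.Iic (β : Ordinal.{0})).Countable := by
    have hlt : Order.succ (β : Ordinal.{0}) < Ordinal.omega 1 :=
      (Cardinal.isSuccLimit_omega 1).succ_lt β.2
    rw [← Order.Iio_succ, ← Cardinal.le_aleph0_iff_set_countable, Cardinal.mk_Iio_ordinal,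
      ← Cardinal.lift_aleph0.{1, 0}, Cardinal.lift_le]
    rw [Cardinal.lt_omega_iff_card_lt, ← Cardinal.succ_aleph0, Order.lt_succ_iff] at hlt
    exact hlt
  exact h.preimage Subtype.val_injective

variable {L : Type*} [TopologicalSpace L]

theorem countable_of_isCompact (hS : HasFiniteToOneMap L) {C : Set L} (hC : IsCompact C) :
    C.Countable := by
  obtain ⟨φ, hφ, hsurj, hfin⟩ := hS
  rcases C.eq_empty_or_nonempty with rfl | ⟨x, -⟩
  · exact Set.countable_empty
  have : Nonempty OmegaOne := ⟨φ x⟩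
  obtain ⟨β, hβ⟩ := (hC.image hφ).bddAbove
  refine ((countable_Iic_omegaOne β).biUnion (t := fun α _ => φ ⁻¹' {α})
    fun α _ => (hfin α).countable).mono fun x hx => ?_
  exact Set.mem_iUnion₂.2 ⟨φ x, hβ ⟨x, hx, rfl⟩, rfl⟩

theorem countable_of_isCompact_prod (hS : HasFiniteToOneMap L) {C : Set (L × L)}
    (hC : IsCompact C) : C.Countable :=
  ((countable_of_isCompact hS (hC.image continuous_fst)).prod
    (countable_of_isCompact hS (hC.image continuous_snd))).mono
    fun _ hz => Set.mem_prod.2 ⟨Set.mem_image_of_mem _ hz, Set.mem_image_of_mem _ hz⟩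

/-- Fibres over successor ordinals are open and finite, so they consist of isolated points. -/
theorem exists_isolated_families [T2Space L] (hS : HasFiniteToOneMap L) :
    ∃ p q : OmegaOne → L, Function.Injective p ∧ Function.Injective q ∧ (∀ α, p α ≠ q α) ∧
      (∀ α, IsOpen {p α}) ∧ ∀ α, IsOpen {q α} := by
  obtain ⟨φ, hφ, hsurj, hfin⟩ := hS
  let s : OmegaOne → OmegaOne := fun α => ⟨Order.succ α, (Cardinal.isSuccLimit_omega 1).succ_lt α.2⟩
  have hs : Function.Injective s := fun α β h =>
    Subtype.ext (Order.succ_injective (congrArg Subtype.val h))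
  have hlt : ∀ α : OmegaOne, (α : Ordinal) < s α := fun α => Order.lt_succ _
  have hiso : ∀ α x, φ x = s α → IsOpen {x} := by
    intro α x hx
    have hopen : IsOpen ({s α} : Set OmegaOne) := by
      have h : IsOpen ({Order.succ (α : Ordinal)} : Set Ordinal) :=
        SuccOrder.isOpen_singleton_iff.2 (Order.not_isSuccLimit_succ _)
      convert h.preimage continuous_subtype_val
      ext β
      exact Subtype.ext_iff
    have h1 := hopen.preimage hφ
    have h2 : IsClosed (φ ⁻¹' {s α} \ {x}) := ((hfin (s α)).subset Set.sdiff_subset).isClosed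
    convert h1.sdiff h2
    ext y
    simp only [Set.mem_singleton_iff, Set.mem_sdiff, Set.mem_preimage]
    constructor
    · rintro rfl
      exact ⟨hx, fun h => h.2 rfl⟩
    · rintro ⟨h, h'⟩
      by_contra hy
      exact h' ⟨h, hy⟩
  choose r hr using hsurj
  have hrinj : Function.Injective r := Function.LeftInverse.injective hr
  refine ⟨fun α => r (s α), fun α => r (s (s α)), hrinj.comp hs, hrinj.comp (hs.comp hs),
    fun α h => ?_, fun α => hiso α _ (hr _), fun α => hiso (s α) _ (hr _)⟩
  exact (hlt (s α)).ne (congrArg Subtype.val (hrinj h))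

end FiniteToOne

/-! ### Collapsing families of tuples -/

section Collapsing

variable {L : Type*} [TopologicalSpace L]

/-- The collapsing property for an uncountable family of pairwise disjoint injective tuples
`g ξ : κ → L`. Copies of the family are indexed by `σ`, and `c s i` prescribes the limit of the
`i`-th coordinate of copy `s`: `none` stands for `∞`, and different `j : τ` stand for different
points of `L`, which may be taken outside a given finite set `R`. -/
theorem exists_collapsing_filter (hL : CollapsingProperty L) {ι : Type*} {κ σ τ : Type}
    [Uncountable ι] [Fintype κ] [Nonempty κ] [Fintype σ] [Fintype τ] (g : ι → κ → L)
    (hg : ∀ ξ η i j, g ξ i = g η j → ξ = η ∧ i = j) (c : σ → κ → Option τ)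
    (hc : ∀ j, ∃ s i, c s i = some j) (R : Finset L) :
    ∃ a : τ → L, Function.Injective a ∧ (∀ j, a j ∉ R) ∧ ∃ ℓ : Filter (σ → ι), ℓ.NeBot ∧
      ∀ s i, Tendsto (fun ξ => (g (ξ s) i : OnePoint L)) ℓ
        (𝓝 ((c s i).elim OnePoint.infty fun j => (a j : OnePoint L))) := by
  classical
  -- There are `R.card + 1` groups of copies, so that the limit points of one group avoid `R`;
  -- one more copy goes to `∞` entirely, so that the block of `∞` is not empty.
  let B := Option (Fin (R.card + 1) × σ)
  let A := B × κ
  let role : A → Option (Fin (R.card + 1) × τ) := fun p =>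
    p.1.elim none fun ts => (c ts.2 p.2).map fun j => (ts.1, j)
  have hrole : Function.Surjective role := by
    rintro (_ | ⟨t, j⟩)
    · exact ⟨(none, Classical.arbitrary κ), rfl⟩
    · obtain ⟨s, i, hsi⟩ := hc j
      exact ⟨(some (t, s), i), by simp [role, hsi]⟩
  obtain ⟨E⟩ : Nonempty (ι × B ≃ ι) := by
    rw [← Cardinal.eq, Cardinal.mk_prod]
    simp only [Cardinal.lift_uzero]
    refine Cardinal.mul_eq_left (Cardinal.aleph0_le_mk ι) ?_ ?_
    · exact (Cardinal.lift_le_aleph0.2 (Cardinal.mk_le_aleph0)).trans (Cardinal.aleph0_le_mk ι)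
    · simp [B]
  let e : A ≃ Fin (Fintype.card A) := Fintype.equivFin A
  let b : Option (Fin (R.card + 1) × τ) ≃ Fin (Fintype.card (Fin (R.card + 1) × τ) + 1) :=
    (Fintype.equivFin _).optionCongr.trans finSuccEquivLast.symm
  let G : ι → A → L := fun t p => g (E (t, p.1)) p.2
  have hG : ∀ t t' p p', G t p = G t' p' → t = t' ∧ p = p' := by
    intro t t' p p' h
    obtain ⟨h1, h2⟩ := hg _ _ _ _ h
    have h3 := E.injective h1
    exact ⟨congrArg Prod.fst h3, Prod.ext (congrArg Prod.snd h3) h2⟩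
  let T : ι → Fin (Fintype.card A) → L := fun t n => G t (e.symm n)
  have hTne : ∀ t t' n n', T t n = T t' n' → t = t' ∧ n = n' := fun t t' n n' h =>
    ⟨(hG _ _ _ _ h).1, e.symm.injective (hG _ _ _ _ h).2⟩
  let n₀ := e (none, Classical.arbitrary κ)
  have hTinj : Function.Injective T := fun t t' h => (hTne t t' n₀ n₀ (congrFun h n₀)).1
  obtain ⟨q, a, hq, ha, halast, hqa⟩ := hL _ _ (fun n => b (role (e.symm n)))
    (b.surjective.comp (hrole.comp e.symm.surjective)) (Set.range T) (by
      intro hcount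
      have : (Set.univ : Set ι).Countable := by
        rw [← Set.preimage_range T]
        exact hcount.preimage hTinj
      exact Set.not_countable_univ this) (by
    refine ⟨⟨fun j => ((fun n => b (role (e.symm n))) ⁻¹' {j}).ncard, fun j => ⟨?_, ?_⟩⟩, ?_⟩
    · obtain ⟨n, hn⟩ := (b.surjective.comp (hrole.comp e.symm.surjective)) j
      exact Set.ncard_ne_zero_of_mem (a := n) hn
    · rintro _ ⟨t, rfl⟩
      exact Set.ncard_image_of_injective _ fun n n' h => (hTne t t n n' h).2
    · rintro _ ⟨t, rfl⟩ _ ⟨t', rfl⟩ i j hij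
      rw [Set.disjoint_left]
      rintro _ ⟨n, hn, rfl⟩ ⟨n', hn', h⟩
      obtain ⟨rfl, rfl⟩ := hTne _ _ _ _ h
      rcases hij with hij | hij
      · exact hij (hn.symm.trans hn')
      · exact hij rfl)
  have hfin : ∀ p : Fin (R.card + 1) × τ, ∃ y : L, (y : OnePoint L) = a (b (some p)) := by
    intro p
    refine OnePoint.ne_infty_iff_exists.1 fun h => ?_
    have hlast : b none = Fin.last _ := by simp [b]
    rw [← halast, ← hlast] at h
    exact absurd (b.injective (ha h)) (by simp)
  choose y hy using hfin
  have hyinj : Function.Injective y := by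
    intro p p' h
    have : a (b (some p)) = a (b (some p')) := by rw [← hy, ← hy, h]
    exact Option.some_injective _ (b.injective (ha this))
  obtain ⟨t, ht⟩ : ∃ t, ∀ j, y (t, j) ∉ R := by
    by_contra! hcon
    choose j hj using hcon
    have := Fintype.card_le_of_injective (fun t => (⟨y (t, j t), hj t⟩ : R)) fun t t' h =>
      congrArg Prod.fst (hyinj (congrArg Subtype.val h))
    simp at this
  have hne : (comap (fun (x : ι) n => (T x n : OnePoint L)) (𝓝 q)).NeBot := by
    rw [comap_neBot_iff]
    intro W hW
    obtain ⟨_, hw, _, ⟨x, rfl⟩, rfl⟩ :=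
      mem_closure_iff_nhds.1 (mem_closure_iff_clusterPt.2 hq.clusterPt) W hW
    exact ⟨x, hw⟩
  refine ⟨fun j => y (t, j), fun j j' h => congrArg Prod.snd (hyinj h), ht,
    map (fun x s => E (x, some (t, s))) (comap (fun (x : ι) n => (T x n : OnePoint L)) (𝓝 q)),
    hne.map _, fun s i => ?_⟩
  rw [tendsto_map'_iff]
  have h := (tendsto_pi_nhds.1 (tendsto_comap (f := fun (x : ι) n => (T x n : OnePoint L))
    (x := 𝓝 q))) (e (some (t, s), i))
  have hlim : q (e (some (t, s), i)) =
      (c s i).elim OnePoint.infty fun j => ((y (t, j) : L) : OnePoint L) := by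
    rw [hqa]
    simp only [Equiv.symm_apply_apply, role, Option.elim_some]
    rcases hcs : c s i with _ | j
    · simpa [b] using halast
    · simp [hy]
  rw [hlim] at h
  convert h using 2
  simp [T, G]

variable [LocallyCompactSpace L] [T2Space L]

/-- Finitely many distinct points off a finite set `R` carry bump functions that are locally
constant near all these points, separate them, and vanish on `R`. -/
theorem exists_bumps {τ : Type*} [Finite τ] (a : τ → L) (ha : Function.Injective a) (R : Finset L)
    (haR : ∀ j, a j ∉ R) :
    ∃ u : τ → C_c(L, ℝ), (∀ j x, u j x ∈ Set.Icc (0 : ℝ) 1) ∧ (∀ j, ∀ r ∈ R, u j r = 0) ∧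
      (∀ j, ∀ᶠ x in 𝓝 (a j), u j x = 1) ∧ ∀ j k, j ≠ k → ∀ᶠ x in 𝓝 (a k), u j x = 0 := by
  obtain ⟨U, hU, hUd⟩ := (Set.finite_range a).t2_separation
  have h : ∀ j, ∃ u : C_c(L, ℝ), (∀ x, u x ∈ Set.Icc (0 : ℝ) 1) ∧ (∀ᶠ x in 𝓝 (a j), u x = 1) ∧
      ∀ x ∉ U (a j) \ R, u x = 0 := by
    intro j
    have hopen : IsOpen (U (a j) \ R) := (hU _).2.sdiff R.finite_toSet.isClosed
    obtain ⟨k, hk, hkU, hkc⟩ := local_compact_nhds (hopen.mem_nhds ⟨(hU (a j)).1, haR j⟩)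
    obtain ⟨f, hf1, hf0, hfc, hf⟩ := exists_continuous_one_zero_of_isCompact hkc
      hopen.isClosed_compl (Set.disjoint_compl_right_iff_subset.2 hkU)
    exact ⟨⟨f, hfc⟩, hf, eventually_of_mem hk fun x hx => hf1 hx, fun x hx => hf0 hx⟩
  choose u hu01 hu1 hu0 using h
  refine ⟨u, hu01, fun j r hr => hu0 j r fun h => h.2 hr, hu1, fun j k hjk => ?_⟩
  filter_upwards [(hU (a k)).2.mem_nhds (hU (a k)).1] with x hx
  exact hu0 j x fun h => Set.disjoint_left.1
    (hUd ⟨j, rfl⟩ ⟨k, rfl⟩ (ha.ne hjk)) h.1 hx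

/-- The collapsing property in terms of test functions: along the filter, `u j` takes the value `1`
at those coordinates that are sent to the point with label `j`, and `0` at all others. -/
theorem exists_collapsing_bumps (hL : CollapsingProperty L) {ι : Type*} {κ σ τ : Type}
    [Uncountable ι] [Fintype κ] [Nonempty κ] [Fintype σ] [Fintype τ] [DecidableEq τ]
    (g : ι → κ → L)
    (hg : ∀ ξ η i j, g ξ i = g η j → ξ = η ∧ i = j) (c : σ → κ → Option τ)
    (hc : ∀ j, ∃ s i, c s i = some j) (R : Finset L) :
    ∃ (lim : Option τ → OnePoint L) (u : τ → C_c(L, ℝ)) (ℓ : Filter (σ → ι)),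
      (∀ j x, u j x ∈ Set.Icc (0 : ℝ) 1) ∧ (∀ j, ∀ r ∈ R, u j r = 0) ∧ ℓ.NeBot ∧
      (∀ s i, Tendsto (fun ξ => (g (ξ s) i : OnePoint L)) ℓ (𝓝 (lim (c s i)))) ∧
      ∀ᶠ ξ in ℓ, ∀ s i j, u j (g (ξ s) i) = if c s i = some j then 1 else 0 := by
  obtain ⟨a, ha, haR, ℓ, hℓ, hlim⟩ := exists_collapsing_filter hL g hg c hc R
  obtain ⟨u, hu01, huR, hu1, hu0⟩ := exists_bumps a ha R haR
  refine ⟨fun o => o.elim OnePoint.infty fun j => (a j : OnePoint L), u, ℓ, hu01, huR, hℓ, hlim, ?_⟩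
  simp only [eventually_all]
  intro s i j
  have h := hlim s i
  rcases hcs : c s i with _ | k
  · rw [hcs, Option.elim_none] at h
    have h' : Tendsto (fun ξ => g (ξ s) i) ℓ (coclosedCompact L) := by
      rw [← OnePoint.comap_coe_nhds_infty, tendsto_comap_iff]
      exact h
    filter_upwards [h'.eventually
      (hasCompactSupport_iff_eventuallyEq.1 (u j).hasCompactSupport)] with ξ hξ
    simpa using hξ
  · rw [hcs, Option.elim_some] at h
    have h' : Tendsto (fun ξ => g (ξ s) i) ℓ (𝓝 (a k)) :=
      OnePoint.isOpenEmbedding_coe.tendsto_nhds_iff.2 h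
    by_cases hjk : j = k
    · subst hjk
      filter_upwards [h'.eventually (hu1 j)] with ξ hξ
      simpa using hξ
    · filter_upwards [h'.eventually (hu0 j k hjk)] with ξ hξ
      simpa [Ne.symm hjk] using hξ

end Collapsing

/-! ### Symmetric and antisymmetric test functions -/

section SymmetrizedTensor

variable {L : Type*} [TopologicalSpace L]

/-- The function `(x, y) ↦ u x * v y + ε * v x * u y`. For `ε = 1` it is symmetric, for `ε = -1`
it is antisymmetric. -/
def symTensor (ε : ℝ) (u v : C_c(L, ℝ)) : C₀(L × L, ℝ) where
  toFun z := u z.1 * v z.2 + ε * (v z.1 * u z.2)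
  continuous_toFun := by fun_prop
  zero_at_infty' := by
    refine HasCompactSupport.is_zero_at_infty
      (f := fun z : L × L => u z.1 * v z.2 + ε * (v z.1 * u z.2)) ?_
    have hK := u.hasCompactSupport.isCompact.union v.hasCompactSupport.isCompact
    refine HasCompactSupport.intro' (hK.prod hK)
      (((isClosed_tsupport _).union (isClosed_tsupport _)).prod
        ((isClosed_tsupport _).union (isClosed_tsupport _))) fun z hz => ?_
    by_cases h : z.1 ∈ tsupport u ∪ tsupport v
    · have h2 : z.2 ∉ tsupport u ∪ tsupport v := fun h2 => hz ⟨h, h2⟩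
      rw [Set.mem_union, not_or] at h2
      simp [image_eq_zero_of_notMem_tsupport h2.1, image_eq_zero_of_notMem_tsupport h2.2]
    · rw [Set.mem_union, not_or] at h
      simp [image_eq_zero_of_notMem_tsupport h.1, image_eq_zero_of_notMem_tsupport h.2]

theorem symTensor_apply (ε : ℝ) (u v : C_c(L, ℝ)) (x y : L) :
    symTensor ε u v (x, y) = u x * v y + ε * (v x * u y) := rfl

theorem norm_symTensor_le {ε : ℝ} (hε : |ε| = 1) (u v : C_c(L, ℝ))
    (hu : ∀ x, u x ∈ Set.Icc (0 : ℝ) 1) (hv : ∀ x, v x ∈ Set.Icc (0 : ℝ) 1) :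
    ‖symTensor ε u v‖ ≤ 2 := by
  rw [norm_le_iff zero_le_two]
  rintro ⟨x, y⟩
  rw [symTensor_apply]
  have h : ∀ w w' : C_c(L, ℝ), (∀ x, w x ∈ Set.Icc (0 : ℝ) 1) → (∀ x, w' x ∈ Set.Icc (0 : ℝ) 1) →
      |w x * w' y| ≤ 1 := by
    intro w w' hw hw'
    rw [abs_of_nonneg (mul_nonneg (hw x).1 (hw' y).1)]
    exact mul_le_one₀ (hw x).2 (hw' y).1 (hw' y).2
  calc |u x * v y + ε * (v x * u y)| ≤ |u x * v y| + |ε * (v x * u y)| := abs_add_le _ _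
    _ ≤ 1 + 1 := by
      rw [abs_mul ε, hε, one_mul]
      exact add_le_add (h u v hu hv) (h v u hv hu)
    _ = 2 := by norm_num

/-- The indicator function of an isolated point. -/
noncomputable def singleFun [T2Space L] (p : L) (hp : IsOpen {p}) : C_c(L, ℝ) where
  toFun := Set.indicator {p} 1
  continuous_toFun := continuous_one.indicator fun x hx => by
    rw [IsClopen.frontier_eq ⟨isClosed_singleton, hp⟩] at hx
    exact hx.elim
  hasCompactSupport' := HasCompactSupport.intro isCompact_singleton fun _ hx =>
    Set.indicator_of_notMem hx _

open Classical in
theorem singleFun_apply [T2Space L] (p : L) (hp : IsOpen {p}) (x : L) :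
    singleFun p hp x = if x = p then 1 else 0 := rfl

end SymmetrizedTensor

/-! ### Operators exchanging the symmetry types -/

section Operators

variable {L : Type*} [TopologicalSpace L]

/-- An uncountable family of data for an operator `T` on `C₀(L × L)` that maps everything to
functions of symmetry type `-ε`. For each index `ξ` there are a pairwise disjoint petal `g ξ` off
the common root `R`, the function `e ξ` of symmetry type `ε` living on the points `(p, q)` and
`(q, p)` with `p = g ξ i` and `q = g ξ j`, and an evaluation point whose coordinates are given by
the positions `xc`, `yc` in the petal or the root. Up to the error `δ`, the evaluation of `T` at
this point is carried by the square of petal and root. -/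
structure OperatorFamily (T : C₀(L × L, ℝ) →L[ℝ] C₀(L × L, ℝ)) (ε δ : ℝ) {ι : Type*} {κ : Type}
    [DecidableEq κ] (g : ι → κ → L) (R : Finset L) (i j : κ) (xc yc : κ ⊕ R)
    (e : ι → C₀(L × L, ℝ)) : Prop where
  abs_eps : |ε| = 1
  delta_pos : 0 < δ
  antisymm : ∀ f x y, T f (y, x) = -ε * T f (x, y)
  inj : ∀ ξ η k l, g ξ k = g η l → ξ = η ∧ k = l
  notMem : ∀ ξ k, g ξ k ∉ R
  ne : i ≠ j
  norm_le : ∀ ξ, ‖e ξ‖ ≤ 2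
  apply_root_left : ∀ ξ, ∀ r ∈ R, ∀ z, e ξ (r, z) = 0
  apply_root_right : ∀ ξ, ∀ r ∈ R, ∀ z, e ξ (z, r) = 0
  apply_petal : ∀ ξ k l, e ξ (g ξ k, g ξ l) =
    (if k = i ∧ l = j then 1 else 0) + ε * (if k = j ∧ l = i then 1 else 0)
  carried : ∀ ξ, ∀ h : C₀(L × L, ℝ),
    (∀ z w, (z ∈ R ∨ z ∈ Set.range (g ξ)) → (w ∈ R ∨ w ∈ Set.range (g ξ)) → h (z, w) = 0) →
      |T h (Sum.elim (g ξ) Subtype.val xc, Sum.elim (g ξ) Subtype.val yc)| ≤ δ * ‖h‖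

namespace OperatorFamily

variable {T : C₀(L × L, ℝ) →L[ℝ] C₀(L × L, ℝ)} {ε δ : ℝ} {ι : Type*} {κ : Type}
    [DecidableEq κ] {g : ι → κ → L} {R : Finset L} {i j : κ} {xc yc : κ ⊕ R}
    {e : ι → C₀(L × L, ℝ)}

theorem eps_mul_self (H : OperatorFamily T ε δ g R i j xc yc e) : ε * ε = 1 := by
  rw [← abs_mul_abs_self, H.abs_eps, one_mul]

/-- The roles of the points `p` and `q` may be exchanged. -/
theorem swap (H : OperatorFamily T ε δ g R i j xc yc e) :
    OperatorFamily T ε δ g R j i xc yc fun ξ => ε • e ξ where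
  abs_eps := H.abs_eps
  delta_pos := H.delta_pos
  antisymm := H.antisymm
  inj := H.inj
  notMem := H.notMem
  ne := H.ne.symm
  norm_le ξ := by rw [norm_smul, Real.norm_eq_abs, H.abs_eps, one_mul]; exact H.norm_le ξ
  apply_root_left ξ r hr z := by simp [H.apply_root_left ξ r hr z]
  apply_root_right ξ r hr z := by simp [H.apply_root_right ξ r hr z]
  apply_petal ξ k l := by
    rw [ZeroAtInftyContinuousMap.smul_apply, H.apply_petal, smul_eq_mul, mul_add, ← mul_assoc,
      H.eps_mul_self]
    ring
  carried := H.carried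

/-- If a test function agrees with `r • e ξ` on the square of petal and root, then `T` takes almost
the same value at both. -/
theorem abs_sub_le (H : OperatorFamily T ε δ g R i j xc yc e) (ξ : ι) (u v : C_c(L, ℝ))
    (hu : ∀ x, u x ∈ Set.Icc (0 : ℝ) 1) (hv : ∀ x, v x ∈ Set.Icc (0 : ℝ) 1)
    (huR : ∀ r ∈ R, u r = 0) (hvR : ∀ r ∈ R, v r = 0) (r : ℝ) (hr : |r| ≤ 1)
    (h : ∀ k l, symTensor ε u v (g ξ k, g ξ l) = r * e ξ (g ξ k, g ξ l)) :
    |T (symTensor ε u v) (Sum.elim (g ξ) Subtype.val xc, Sum.elim (g ξ) Subtype.val yc)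
      - r * T (e ξ) (Sum.elim (g ξ) Subtype.val xc, Sum.elim (g ξ) Subtype.val yc)| ≤ 4 * δ := by
  have h1 := H.carried ξ (symTensor ε u v - r • e ξ) (by
    rintro z w (hz | ⟨k, rfl⟩) hw
    · simp [symTensor_apply, huR z hz, hvR z hz, H.apply_root_left ξ z hz]
    · rcases hw with hw | ⟨l, rfl⟩
      · simp [symTensor_apply, huR w hw, hvR w hw, H.apply_root_right ξ w hw]
      · simp [h k l])
  have h2 : ‖symTensor ε u v - r • e ξ‖ ≤ 4 := by
    have := norm_symTensor_le H.abs_eps u v hu hv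
    have h3 : ‖r • e ξ‖ ≤ 1 * 2 := by
      rw [norm_smul]
      exact mul_le_mul hr (H.norm_le ξ) (norm_nonneg _) zero_le_one
    linarith [norm_sub_le (symTensor ε u v) (r • e ξ)]
  rw [map_sub, map_smul] at h1
  refine h1.trans ?_
  rw [mul_comm]
  exact mul_le_mul_of_nonneg_right h2 H.delta_pos.le

variable [LocallyCompactSpace L] [T2Space L]

/-- Suppose that the evaluation point does not involve `q`. Let `p` converge to the same point of
`L` in two copies of the family, while `q` converges to a point of `L` in the first copy and to `∞` in
the second. The evaluation points of the copies have a common limit, but the test function has the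
same effect as `e ξ` on the first copy and vanishes on the second. -/
theorem exists_abs_le_of_ne (H : OperatorFamily T ε δ g R i j xc yc e)
    (hL : CollapsingProperty L) [Uncountable ι] [Fintype κ] (hx : xc ≠ Sum.inl j)
    (hy : yc ≠ Sum.inl j) :
    ∃ ξ, |T (e ξ) (Sum.elim (g ξ) Subtype.val xc, Sum.elim (g ξ) Subtype.val yc)| ≤ 10 * δ := by
  have : Nonempty κ := ⟨i⟩
  have hij := H.ne
  let c : Bool → κ → Option Bool := fun s k =>
    if k = i then some true else if k = j ∧ s = true then some false else none
  obtain ⟨lim, u, ℓ, hu, huR, hℓ, hlim, hev⟩ := exists_collapsing_bumps hL g H.inj c (by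
    rintro (_ | _)
    · exact ⟨true, j, by simp [c, hij.symm]⟩
    · exact ⟨true, i, by simp [c]⟩) R
  obtain ⟨F, hF, hFT⟩ := exists_continuous_extension (T (symTensor ε (u true) (u false)))
  have hpt : ∀ k : κ ⊕ R, k ≠ Sum.inl j → ∃ w : OnePoint L, ∀ s,
      Tendsto (fun ξ : Bool → ι => ((Sum.elim (g (ξ s)) Subtype.val k : L) : OnePoint L))
        ℓ (𝓝 w) := by
    rintro (k | r) hk
    · refine ⟨lim (c true k), fun s => ?_⟩
      have hkj : k ≠ j := fun h => hk (h ▸ rfl)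
      have : c true k = c s k := by simp [c, hkj]
      rw [this]
      exact hlim s k
    · exact ⟨((r : L) : OnePoint L), fun s => tendsto_const_nhds⟩
  obtain ⟨X, hX⟩ := hpt xc hx
  obtain ⟨Y, hY⟩ := hpt yc hy
  have hconv : ∀ s, Tendsto (fun ξ : Bool → ι => T (symTensor ε (u true) (u false))
      (Sum.elim (g (ξ s)) Subtype.val xc, Sum.elim (g (ξ s)) Subtype.val yc)) ℓ
      (𝓝 (F (X, Y))) := by
    intro s
    simp only [← hFT]
    exact (hF.tendsto _).comp ((hX s).prodMk_nhds (hY s))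
  have hdiff := ((hconv true).sub (hconv false)).eventually
    (Metric.ball_mem_nhds _ H.delta_pos)
  rw [sub_self] at hdiff
  obtain ⟨ξ, hξ, hd⟩ := (hev.and hdiff).exists
  rw [dist_zero_right, Real.norm_eq_abs] at hd
  refine ⟨ξ true, ?_⟩
  have h1 := H.abs_sub_le (ξ true) (u true) (u false) (hu _) (hu _) (huR _) (huR _) 1 (by simp)
    (fun k l => by
      rw [symTensor_apply, H.apply_petal, hξ, hξ, hξ, hξ]
      simp only [c]
      grind)
  have h2 := H.abs_sub_le (ξ false) (u true) (u false) (hu _) (hu _) (huR _) (huR _) 0 (by simp)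
    (fun k l => by
      rw [symTensor_apply, hξ, hξ, hξ, hξ]
      simp only [c]
      grind)
  have hδ := H.delta_pos
  grind

/-- Suppose that the evaluation point is `(p, q)`. Let `(p, q)` converge to `(a, b)` in one copy of
the family and to `(b, a)` in another one. The test function of symmetry type `ε` has the same
effect as `e ξ` on the first copy and as `ε • e ξ` on the second, while the symmetry type of the
image is `-ε`. So the values of `T (e ξ)` cannot all have the same sign. -/
theorem exists_mul_le_of_eq (H : OperatorFamily T ε δ g R i j (Sum.inl i) (Sum.inl j) e)
    (hL : CollapsingProperty L) [Uncountable ι] [Fintype κ] {s : ℝ} (hs : |s| = 1) :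
    ∃ ξ, s * T (e ξ) (g ξ i, g ξ j) ≤ 10 * δ := by
  have : Nonempty κ := ⟨i⟩
  have hij := H.ne
  let c : Bool → κ → Option Bool := fun s k =>
    if k = i then some s else if k = j then some (!s) else none
  obtain ⟨lim, u, ℓ, hu, huR, hℓ, hlim, hev⟩ := exists_collapsing_bumps hL g H.inj c (by
    intro b
    exact ⟨b, i, by simp [c]⟩) R
  obtain ⟨F, hF, hFT⟩ := exists_continuous_extension (T (symTensor ε (u true) (u false)))
  have hconv : ∀ s k l, Tendsto (fun ξ : Bool → ι => T (symTensor ε (u true) (u false))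
      (g (ξ s) k, g (ξ s) l)) ℓ (𝓝 (F (lim (c s k), lim (c s l)))) := by
    intro s k l
    simp only [← hFT]
    exact (hF.tendsto _).comp ((hlim s k).prodMk_nhds (hlim s l))
  have hlims : (lim (c false j), lim (c false i)) = (lim (c true i), lim (c true j)) := by
    simp [c, hij.symm]
  have hconv' := hconv false j i
  rw [hlims] at hconv'
  have hdiff := ((hconv true i j).sub hconv').eventually (Metric.ball_mem_nhds _ H.delta_pos)
  rw [sub_self] at hdiff
  obtain ⟨ξ, hξ, hd⟩ := (hev.and hdiff).exists
  rw [dist_zero_right, Real.norm_eq_abs, H.antisymm _ (g (ξ false) i)] at hd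
  have h1 := H.abs_sub_le (ξ true) (u true) (u false) (hu _) (hu _) (huR _) (huR _) 1 (by simp)
    (fun k l => by
      rw [symTensor_apply, H.apply_petal, hξ, hξ, hξ, hξ]
      simp only [c]
      grind)
  have h2 := H.abs_sub_le (ξ false) (u true) (u false) (hu _) (hu _) (huR _) (huR _) ε
    H.abs_eps.le (fun k l => by
      have := H.eps_mul_self
      rw [symTensor_apply, H.apply_petal, hξ, hξ, hξ, hξ]
      simp only [c]
      grind)
  simp only [Sum.elim_inl, one_mul] at h1 h2
  have hδ := H.delta_pos
  by_contra! hcon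
  have hc1 := hcon (ξ true)
  have hc2 := hcon (ξ false)
  have hε : ε = 1 ∨ ε = -1 := eq_or_eq_neg_of_abs_eq H.abs_eps
  have hs' : s = 1 ∨ s = -1 := eq_or_eq_neg_of_abs_eq hs
  rw [abs_le] at h1 h2
  rw [abs_lt] at hd
  rcases hε with rfl | rfl <;> rcases hs' with rfl | rfl <;> linarith

/-- The values of `T (e ξ)` at the evaluation points cannot be large and of constant sign. -/
theorem exists_mul_le (H : OperatorFamily T ε δ g R i j xc yc e) (hL : CollapsingProperty L)
    [Uncountable ι] [Fintype κ] {s : ℝ} (hs : |s| = 1) :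
    ∃ ξ, s * T (e ξ) (Sum.elim (g ξ) Subtype.val xc, Sum.elim (g ξ) Subtype.val yc) ≤ 10 * δ := by
  have habs : ∀ t r : ℝ, |t| = 1 → |r| ≤ 10 * δ → t * r ≤ 10 * δ := fun t r ht hr =>
    (le_abs_self _).trans (by rwa [abs_mul, ht, one_mul])
  by_cases hj : xc ≠ Sum.inl j ∧ yc ≠ Sum.inl j
  · obtain ⟨ξ, hξ⟩ := H.exists_abs_le_of_ne hL hj.1 hj.2
    exact ⟨ξ, habs _ _ hs hξ⟩
  have hεε := H.eps_mul_self
  by_cases hi : xc ≠ Sum.inl i ∧ yc ≠ Sum.inl i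
  · obtain ⟨ξ, hξ⟩ := H.swap.exists_abs_le_of_ne hL hi.1 hi.2
    refine ⟨ξ, habs _ _ hs ?_⟩
    rwa [map_smul, ZeroAtInftyContinuousMap.smul_apply, smul_eq_mul, abs_mul, H.abs_eps,
      one_mul] at hξ
  have hne : (Sum.inl i : κ ⊕ R) ≠ Sum.inl j := fun h => H.ne (Sum.inl_injective h)
  have hcases : (xc = Sum.inl i ∧ yc = Sum.inl j) ∨ (xc = Sum.inl j ∧ yc = Sum.inl i) := by
    grind
  rcases hcases with ⟨rfl, rfl⟩ | ⟨rfl, rfl⟩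
  · exact H.exists_mul_le_of_eq hL hs
  · obtain ⟨ξ, hξ⟩ := H.swap.exists_mul_le_of_eq hL (s := s * ε)
      (by rw [abs_mul, hs, H.abs_eps, one_mul])
    refine ⟨ξ, ?_⟩
    rw [map_smul, ZeroAtInftyContinuousMap.smul_apply, smul_eq_mul, mul_assoc, ← mul_assoc ε,
      hεε, one_mul] at hξ
    exact hξ

end OperatorFamily

end Operators

/-! ### Kernels of operators between the symmetric and antisymmetric functions -/

section Kernel

variable {L : Type*} [TopologicalSpace L] [LocallyCompactSpace L] [T2Space L]

/-- An operator that turns the symmetry type `ε` into the opposite one annihilates some nonzero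
function of type `ε`. Otherwise `T` would be nonzero at the functions living on `(p, q)` and
`(q, p)` for uncountably many disjoint pairs of isolated points, and thinning out these pairs would
give an `OperatorFamily` of large values of constant sign. -/
theorem exists_ne_zero_of_antisymm (hS : HasFiniteToOneMap L) (hL : CollapsingProperty L)
    {ε : ℝ} (hε : |ε| = 1) (T : C₀(L × L, ℝ) →L[ℝ] C₀(L × L, ℝ))
    (hT : ∀ f x y, T f (y, x) = -ε * T f (x, y)) :
    ∃ f : C₀(L × L, ℝ), f ≠ 0 ∧ (∀ x y, f (y, x) = ε * f (x, y)) ∧ T f = 0 := by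
  classical
  have hεε : ε * ε = 1 := by rw [← abs_mul_abs_self, hε, one_mul]
  obtain ⟨p, q, hpinj, hqinj, hpq, hp, hq⟩ := exists_isolated_families hS
  by_contra! hcon
  set e : OmegaOne → C₀(L × L, ℝ) := fun α =>
    symTensor ε (singleFun (p α) (hp α)) (singleFun (q α) (hq α))
  have he_apply : ∀ α x y, e α (x, y) = (if x = p α then 1 else 0) * (if y = q α then 1 else 0) +
      ε * ((if x = q α then 1 else 0) * (if y = p α then 1 else 0)) := fun α x y => rfl
  have hTe : ∀ α, ∃ x y, T (e α) (x, y) ≠ 0 := by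
    intro α
    have hne : T (e α) ≠ 0 := by
      refine hcon (e α) (fun h => ?_) fun x y => ?_
      · have h1 : e α (p α, q α) = 1 := by simp [he_apply, hpq α]
        rw [h] at h1
        exact zero_ne_one h1
      · simp only [he_apply]
        linear_combination (-(if x = q α then (1 : ℝ) else 0) * (if y = p α then 1 else 0)) * hεε
    by_contra! h
    exact hne (ZeroAtInftyContinuousMap.ext fun z => h z.1 z.2)
  choose x y hxy using hTe
  -- Uncountably many of the values have the same sign and are bounded away from zero.
  have hsize : ∀ α, ∃ b : Bool × ℕ, 1 / ((b.2 : ℝ) + 1) <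
      (if b.1 then 1 else -1) * T (e α) (x α, y α) := by
    intro α
    obtain ⟨n, hn⟩ := exists_nat_one_div_lt (abs_pos.2 (hxy α))
    rcases abs_cases (T (e α) (x α, y α)) with h | h
    · exact ⟨(true, n), by simpa [h.1] using hn⟩
    · exact ⟨(false, n), by simpa [h.1] using hn⟩
  choose b hb using hsize
  obtain ⟨⟨sgn, n⟩, hS₁⟩ := exists_not_countable_fiber not_countable_omegaOne b
  set s : ℝ := if sgn then 1 else -1 with hsdef
  have hs : |s| = 1 := by rcases sgn with _ | _ <;> simp [hsdef]
  have hδ : (0 : ℝ) < 1 / ((n : ℝ) + 1) / 10 := by positivity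
  set δ := 1 / ((n : ℝ) + 1) / 10 with hδdef
  -- The evaluation functionals are almost carried by finite sets.
  let ev : L × L → C₀(L × L, ℝ) →L[ℝ] ℝ := fun z => LinearMap.mkContinuous
    ⟨⟨fun f => f z, fun _ _ => rfl⟩, fun _ _ => rfl⟩ 1 fun f => by
      rw [one_mul]; exact abs_apply_le_norm f z
  have hcarr : ∀ α, ∃ A : Finset (L × L), ∀ h : C₀(L × L, ℝ), (∀ z ∈ A, h z = 0) →
      |T h (x α, y α)| ≤ δ * ‖h‖ := fun α =>
    exists_finset_forall_abs_le (fun _ hC => countable_of_isCompact_prod hS hC)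
      ((ev (x α, y α)).comp T) hδ
  choose A hA using hcarr
  let F : OmegaOne → Finset L := fun α =>
    (A α).image Prod.fst ∪ (A α).image Prod.snd ∪ {p α, q α, x α, y α}
  obtain ⟨R, S₂, hS₂₁, hS₂, hRF, hdisj⟩ := exists_deltaSystem hS₁ F
  have hS₃ : ¬ {α ∈ S₂ | p α ∉ R ∧ q α ∉ R}.Countable := by
    intro h
    have h1 : (p ⁻¹' (R : Set L)).Countable := R.finite_toSet.countable.preimage hpinj
    have h2 : (q ⁻¹' (R : Set L)).Countable := R.finite_toSet.countable.preimage hqinj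
    refine hS₂ (((h.union h1).union h2).mono fun α hα => ?_)
    by_cases h3 : p α ∈ R
    · exact Or.inl (Or.inr h3)
    by_cases h4 : q α ∈ R
    · exact Or.inr h4
    exact Or.inl (Or.inl ⟨hα, h3, h4⟩)
  obtain ⟨m, hS₄⟩ := exists_not_countable_fiber hS₃ fun α => (F α \ R).card
  set S₄ := {α ∈ {α ∈ S₂ | p α ∉ R ∧ q α ∉ R} | (F α \ R).card = m} with hS₄def
  let enum : ∀ α : S₄, {z // z ∈ F α \ R} ≃ Fin m := fun α => Finset.equivFinOfCardEq α.2.2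
  let g : S₄ → Fin m → L := fun α k => (enum α).symm k
  have hg_mem : ∀ (α : S₄) k, g α k ∈ F α \ R := fun α k => ((enum α).symm k).2
  have hg_surj : ∀ (α : S₄) z, z ∈ F α \ R → ∃ k, g α k = z := fun α z hz =>
    ⟨enum α ⟨z, hz⟩, by simp [g]⟩
  have hF : ∀ α, p α ∈ F α ∧ q α ∈ F α ∧ x α ∈ F α ∧ y α ∈ F α := by
    intro α
    simp [F]
  -- The positions of the special points in petal and root may be taken constant.
  have hcode : ∀ (α : S₄) z, z ∈ F α → ∃ k : Fin m ⊕ R, Sum.elim (g α) Subtype.val k = z := by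
    intro α z hz
    by_cases hzR : z ∈ R
    · exact ⟨Sum.inr ⟨z, hzR⟩, rfl⟩
    · obtain ⟨k, hk⟩ := hg_surj α z (Finset.mem_sdiff.2 ⟨hz, hzR⟩)
      exact ⟨Sum.inl k, hk⟩
  have hcodes : ∀ α : S₄, ∃ k : (Fin m × Fin m) × (Fin m ⊕ R) × (Fin m ⊕ R),
      (g α k.1.1 = p α ∧ g α k.1.2 = q α) ∧
      Sum.elim (g α) Subtype.val k.2.1 = x α ∧ Sum.elim (g α) Subtype.val k.2.2 = y α := by
    intro α
    obtain ⟨h1, h2, h3, h4⟩ := hF α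
    obtain ⟨i, hi⟩ := hg_surj α _ (Finset.mem_sdiff.2 ⟨h1, α.2.1.2.1⟩)
    obtain ⟨j, hj⟩ := hg_surj α _ (Finset.mem_sdiff.2 ⟨h2, α.2.1.2.2⟩)
    obtain ⟨k, hk⟩ := hcode α _ h3
    obtain ⟨l, hl⟩ := hcode α _ h4
    exact ⟨((i, j), (k, l)), ⟨hi, hj⟩, hk, hl⟩
  choose code hcode using hcodes
  have hS₄' : ¬ (Set.univ : Set S₄).Countable := by
    rwa [Set.countable_univ_iff, Set.countable_coe_iff]
  obtain ⟨⟨⟨i, j⟩, xc, yc⟩, hS₅⟩ := exists_not_countable_fiber hS₄' code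
  set S₅ := {α ∈ (Set.univ : Set S₄) | code α = ((i, j), xc, yc)} with hS₅def
  have hunc : Uncountable S₅ := by
    rwa [← not_countable_iff, Set.countable_coe_iff]
  have hcode' : ∀ α : S₅, (g α i = p (α : S₄) ∧ g α j = q (α : S₄)) ∧
      Sum.elim (g α) Subtype.val xc = x (α : S₄) ∧
      Sum.elim (g α) Subtype.val yc = y (α : S₄) := by
    intro α
    have h := hcode α
    rw [α.2.2] at h
    exact h
  have hg_ne : ∀ (α β : S₄) k l, g α k = g β l → α = β ∧ k = l := by
    intro α β k l h
    have hαβ : α = β := by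
      by_contra hne
      refine Finset.disjoint_left.1 (hdisj α.2.1.1 β.2.1.1 fun h' => hne (Subtype.ext h'))
        (hg_mem α k) ?_
      rw [h]
      exact hg_mem β l
    subst hαβ
    exact ⟨rfl, (enum α).symm.injective (Subtype.ext h)⟩
  have H : OperatorFamily T ε δ (fun α : S₅ => g α) R i j xc yc (fun α : S₅ => e (α : S₄)) :=
    { abs_eps := hε
      delta_pos := hδ
      antisymm := hT
      inj := fun α β k l h => by
        obtain ⟨h1, h2⟩ := hg_ne _ _ k l h
        exact ⟨Subtype.ext h1, h2⟩
      notMem := fun α k => (Finset.mem_sdiff.1 (hg_mem α k)).2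
      ne := by
        obtain ⟨α⟩ : Nonempty S₅ := inferInstance
        rintro rfl
        exact hpq _ ((hcode' α).1.1.symm.trans (hcode' α).1.2)
      norm_le := fun α => norm_symTensor_le hε _ _
        (fun z => by rw [singleFun_apply]; split_ifs <;> simp)
        (fun z => by rw [singleFun_apply]; split_ifs <;> simp)
      apply_root_left := fun α r hr z => by
        have h1 : r ≠ p (α : S₄) := fun h => α.1.2.1.2.1 (h ▸ hr)
        have h2 : r ≠ q (α : S₄) := fun h => α.1.2.1.2.2 (h ▸ hr)
        simp [he_apply, h1, h2]
      apply_root_right := fun α r hr z => by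
        have h1 : r ≠ p (α : S₄) := fun h => α.1.2.1.2.1 (h ▸ hr)
        have h2 : r ≠ q (α : S₄) := fun h => α.1.2.1.2.2 (h ▸ hr)
        simp [he_apply, h1, h2]
      apply_petal := fun α k l => by
        have hinj : ∀ k l, g α k = g α l ↔ k = l := fun k l =>
          ⟨fun h => (hg_ne _ _ k l h).2, fun h => h ▸ rfl⟩
        rw [he_apply, ← (hcode' α).1.1, ← (hcode' α).1.2]
        simp only [hinj, ite_and]
        split_ifs <;> simp
      carried := fun α h hh => by
        rw [(hcode' α).2.1, (hcode' α).2.2]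
        refine hA _ h fun z hz => ?_
        have hmem : ∀ w ∈ F (α : S₄), w ∈ R ∨ w ∈ Set.range (g α) := by
          intro w hw
          by_cases hwR : w ∈ R
          · exact Or.inl hwR
          · exact Or.inr (hg_surj α w (Finset.mem_sdiff.2 ⟨hw, hwR⟩))
        refine hh z.1 z.2 (hmem _ ?_) (hmem _ ?_)
        · exact Finset.mem_union_left _ (Finset.mem_union_left _ (Finset.mem_image_of_mem _ hz))
        · exact Finset.mem_union_left _ (Finset.mem_union_right _ (Finset.mem_image_of_mem _ hz)) }
  obtain ⟨α, hα⟩ := H.exists_mul_le hL hs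
  simp only [(hcode' α).2.1, (hcode' α).2.2] at hα
  have h1 := hb (α : S₄)
  rw [(hS₂₁ (α : S₄).2.1.1).2] at h1
  have h2 : 10 * δ = 1 / ((n : ℝ) + 1) := by rw [hδdef]; ring
  rw [h2] at hα
  exact absurd h1 (not_lt.2 hα)

theorem not_injective_symm_antisymm (hS : HasFiniteToOneMap L) (hL : CollapsingProperty L)
    (T : SymmRange L →L[ℝ] AntisymmRange L) : ¬ Function.Injective T := by
  intro hinj
  let P : C₀(L × L, ℝ) →L[ℝ] SymmRange L := (P₁ L).codRestrict (SymmRange L) fun f => ⟨f, rfl⟩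
  obtain ⟨f, hf0, hf, hTf⟩ := exists_ne_zero_of_antisymm hS hL (ε := 1) (by simp)
    ((AntisymmRange L).subtypeL.comp (T.comp P)) (fun f x y => by
      have := (mem_antisymmRange _).1 (T (P f)).2 y x
      simpa using this)
  have hPf : (P f : C₀(L × L, ℝ)) = f := by
    ext ⟨x, y⟩
    change (1 / 2 : ℝ) * (f (x, y) + f (y, x)) = f (x, y)
    rw [hf]
    ring
  have h0 : P f = 0 := hinj ((Subtype.ext hTf : T (P f) = 0).trans (map_zero T).symm)
  rw [h0] at hPf
  exact hf0 hPf.symm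

theorem not_injective_antisymm_symm (hS : HasFiniteToOneMap L) (hL : CollapsingProperty L)
    (T : AntisymmRange L →L[ℝ] SymmRange L) : ¬ Function.Injective T := by
  intro hinj
  let P : C₀(L × L, ℝ) →L[ℝ] AntisymmRange L :=
    (P₂ L).codRestrict (AntisymmRange L) fun f => ⟨f, rfl⟩
  obtain ⟨f, hf0, hf, hTf⟩ := exists_ne_zero_of_antisymm hS hL (ε := -1) (by simp)
    ((SymmRange L).subtypeL.comp (T.comp P)) (fun f x y => by
      have := (mem_symmRange _).1 (T (P f)).2 y x
      simpa using this)
  have hPf : (P f : C₀(L × L, ℝ)) = f := by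
    ext ⟨x, y⟩
    change (1 / 2 : ℝ) * (f (x, y) - f (y, x)) = f (x, y)
    rw [hf]
    ring
  have h0 : P f = 0 := hinj ((Subtype.ext hTf : T (P f) = 0).trans (map_zero T).symm)
  rw [h0] at hPf
  exact hf0 hPf.symm

end Kernel

end CollapsingSpace

theorem proposition6p1 {L : Type*} [TopologicalSpace L] [LocallyCompactSpace L] [T2Space L]
    (hS : CollapsingSpace.HasFiniteToOneMap L) (hL : CollapsingSpace.CollapsingProperty L) :
    (¬ ∃ T : CollapsingSpace.SymmRange L →L[ℝ] CollapsingSpace.AntisymmRange L,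
      Function.Injective T) ∧
    (¬ ∃ T : CollapsingSpace.AntisymmRange L →L[ℝ] CollapsingSpace.SymmRange L,
      Function.Injective T) ∧
    IsEmpty (CollapsingSpace.SymmRange L ≃L[ℝ] CollapsingSpace.AntisymmRange L) ∧
    IsEmpty (CollapsingSpace.SymmRange L ≃L[ℝ] C₀(L × L, ℝ)) ∧
    IsEmpty (CollapsingSpace.AntisymmRange L ≃L[ℝ] C₀(L × L, ℝ)) := by
  have h1 := CollapsingSpace.not_injective_symm_antisymm hS hL
  have h2 := CollapsingSpace.not_injective_antisymm_symm hS hL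
  refine ⟨fun ⟨T, hT⟩ => h1 T hT, fun ⟨T, hT⟩ => h2 T hT, ⟨fun E => h1 E E.injective⟩,
    ⟨fun E => ?_⟩, ⟨fun E => ?_⟩⟩
  · exact h2 ((E.symm : C₀(L × L, ℝ) →L[ℝ] CollapsingSpace.SymmRange L).comp
      (CollapsingSpace.AntisymmRange L).subtypeL) (E.symm.injective.comp Subtype.val_injective)
  · exact h1 ((E.symm : C₀(L × L, ℝ) →L[ℝ] CollapsingSpace.AntisymmRange L).comp
      (CollapsingSpace.SymmRange L).subtypeL) (E.symm.injective.comp Subtype.val_injective)
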